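/- Let $n\ge 0$ and let $L_n$ be the linear hexagonal chain with $n$ hexagons: its $4n+2$ vertices are $p_0,\dots,p_n$, $q_0,\dots,q_n$, $u_0,\dots,u_{n-1}$, $v_0,\dots,v_{n-1}$, and its $5n+1$ edges are $p_iq_i$ ($0\le i\le n$) and $p_iu_i,\ u_ip_{i+1},\ q_iv_i,\ v_iq_{i+1}$ ($0\le i\le n-1$). Regard every edge as a unit resistor and let $r(x,y)$ be the resistance distance (effective resistance) between the vertices $x,y$, i.e. $r(x,y)=\varphi(x)-\varphi(y)$ for any potential $\varphi$ with $\mathcal L\varphi=\mathbf 1_x-\mathbf 1_y$, where $\mathcal L$ is the Laplacian matrix of $L_n$. Put $\alpha=3-2\sqrt2$. Then the following hold. For $0\le i\le n$: $$r(p_n,p_i)=n-i+\frac{(1-\alpha^{n-i})(2-2\alpha^{n+i+2}-\alpha^{n+i+1}-\alpha^{n-i+1}+\alpha^{2i+1}+\alpha)}{4\sqrt2(1-\alpha^{2n+2})},$$ $$r(p_n,q_i)=n-i+\frac{(1+\alpha^{n-i})(2+2\alpha^{n+i+2}+\alpha^{n+i+1}+\alpha^{n-i+1}+\alpha^{2i+1}+\alpha)}{4\sqrt2(1-\alpha^{2n+2})},$$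 $$r(p_i,q_i)=\frac{(1+\alpha^{2n-2i+1})(1+\alpha^{2i+1})}{\sqrt2(1-\alpha^{2n+2})}.$$ For $0\le j\le i\le n$: $$r(p_i,p_j)=i-j+\frac{1-\alpha^{i-j}}{4\sqrt2(1-\alpha^{2n+2})}\Bigl(2-\alpha^{i+j+1}+\alpha^{2j+1}+\alpha^{2n-2i+1}(1-\alpha^{i-j}-2\alpha^{i+j+1})\Bigr),$$ $$r(q_i,p_j)=i-j+\frac{1+\alpha^{i-j}}{4\sqrt2(1-\alpha^{2n+2})}\Bigl(2+\alpha^{i+j+1}+\alpha^{2j+1}+\alpha^{2n-2i+1}(1+\alpha^{i-j}+2\alpha^{i+j+1})\Bigr).$$ For $0\le i\le n-1$: $$r(u_i,v_i)=\frac{\sqrt2(1+\alpha^{2i+2})(1+\alpha^{2n-2i})}{1-\alpha^{2n+2}},$$ $$r(p_n,u_i)=\frac{\sqrt2(1-\alpha^{n-i})(3+\alpha^{2i+2}-\alpha^{n-i}-3\alpha^{n+i+2})}{4(1-\alpha^{2n+2})}+n-i-1,$$ $$r(p_n,v_i)=\frac{\sqrt2(1+\alpha^{n-i})(3+\alpha^{2i+2}+\alpha^{n-i}+3\alpha^{n+i+2})}{4(1-\alpha^{2n+2})}+n-i-1.$$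 For $0\le j\le i\le n-1$: $$r(u_i,p_j)=i-j+\frac{S-T}{4\sqrt2(1-\alpha^{2n+2})},\qquad r(v_i,p_j)=i-j+\frac{S+T}{4\sqrt2(1-\alpha^{2n+2})},$$ where $S=2\alpha^{2i+2}+\alpha^{2n-2j+1}+2\alpha^{2n-2i}+\alpha^{2n+3}+\alpha^{-1}+\alpha^{2j+1}$ and $T=\alpha^{-i-j}(\alpha+1)(1+\alpha^{2j+1})(\alpha^{2i}+\alpha^{2n})$, and $$r(u_i,u_j)=i-j+\frac{(\alpha^{i+1}-\alpha^{j+1})(\alpha^{i+1}-\alpha^{j+1}-2\alpha^{-j-1}+\alpha^{2n-i-2j-1}-\alpha^{2n-j-2i-1}+2\alpha^{2n-i+1})}{2\sqrt2(1-\alpha^{2n+2})},$$ $$r(v_i,u_j)=i-j+\frac{(\alpha^{i+1}+\alpha^{j+1})(\alpha^{i+1}+\alpha^{j+1}+2\alpha^{-j-1}+\alpha^{2n-i-2j-1}+\alpha^{2n-j-2i-1}+2\alpha^{2n-i+1})}{2\sqrt2(1-\alpha^{2n+2})}.$$ Moreover $r(x,x)=0$, $r(x,y)=r(y,x)$, and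 $r$ is invariant under the two reflections $p_i\leftrightarrow q_i,\ u_i\leftrightarrow v_i$ and $p_i\mapsto p_{n-i},\ q_i\mapsto q_{n-i},\ u_i\mapsto u_{n-1-i},\ v_i\mapsto v_{n-1-i}$; hence these formulae determine $r(x,y)$ for every pair of vertices $x,y$ of $L_n$. -/

import Mathlib

/-! Resistance distance in a finite simple graph all of whose edges are unit resistors. -/

section Resistance

variable {V : Type*} [Fintype V] [DecidableEq V] (G : SimpleGraph V) [DecidableRel G.Adj]

/-- `φ` is an electric potential on `G` (every edge being a unit resistor) for which a current of
one unit enters the network at `a` and leaves it at `b`. By Ohm's law the current along an edge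
`xy` is `φ x - φ y`, so the net current leaving `x` is `(L φ) x` with `L` the Laplacian of `G`;
Kirchhoff's current law says that `L φ = 1_a - 1_b`. -/
def IsUnitCurrentPotential (a b : V) (φ : V → ℝ) : Prop :=
  (G.lapMatrix ℝ).mulVec φ = Pi.single a 1 - Pi.single b 1

open Classical in
/-- The resistance distance (effective resistance) between `a` and `b`: the potential difference
`φ a - φ b` when a unit current enters at `a` and leaves at `b`. It does not depend on the chosen
potential, see `resistanceDistance_eq`. If there is no such potential (`a` and `b` lie in
different components), the value is `0` by convention. -/
noncomputable def resistanceDistance (a b : V) : ℝ :=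
  if h : ∃ φ : V → ℝ, IsUnitCurrentPotential G a b φ then h.choose a - h.choose b else 0

/-- Any two unit current potentials give the same potential difference. -/
theorem IsUnitCurrentPotential.sub_eq_sub {a b : V} {φ ψ : V → ℝ}
    (hφ : IsUnitCurrentPotential G a b φ) (hψ : IsUnitCurrentPotential G a b ψ) :
    φ a - φ b = ψ a - ψ b := by
  have key : ∀ χ : V → ℝ,
      dotProduct χ ((Pi.single a 1 : V → ℝ) - Pi.single b 1) = χ a - χ b := by
    intro χ
    simp [dotProduct_sub]
  have hs : dotProduct φ ((G.lapMatrix ℝ).mulVec ψ)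
      = dotProduct ψ ((G.lapMatrix ℝ).mulVec φ) := by
    rw [Matrix.dotProduct_mulVec, ← Matrix.mulVec_transpose, (G.isSymm_lapMatrix (R := ℝ)).eq,
      dotProduct_comm]
  rw [← key φ, ← key ψ]
  unfold IsUnitCurrentPotential at hφ hψ
  rw [hψ, hφ] at hs
  exact hs

/-- The resistance distance can be computed from any unit current potential. -/
theorem resistanceDistance_eq {a b : V} {φ : V → ℝ} (hφ : IsUnitCurrentPotential G a b φ) :
    resistanceDistance G a b = φ a - φ b := by
  have h : ∃ φ : V → ℝ, IsUnitCurrentPotential G a b φ := ⟨φ, hφ⟩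
  rw [resistanceDistance, dif_pos h]
  exact h.choose_spec.sub_eq_sub G hφ

end Resistance

/-! The linear hexagonal chain. -/

/-- The `4 n + 2` vertices of the linear hexagonal chain with `n` hexagons:
`p_i`, `q_i` for `0 ≤ i ≤ n` and `u_i`, `v_i` for `0 ≤ i ≤ n - 1`. -/
inductive HexVertex (n : ℕ) : Type
  | p (i : Fin (n + 1)) : HexVertex n
  | q (i : Fin (n + 1)) : HexVertex n
  | u (i : Fin n) : HexVertex n
  | v (i : Fin n) : HexVertex n
  deriving DecidableEq, Fintype

namespace HexVertex

variable {n : ℕ}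

/-- The edges of the chain, each listed in one direction: `p_i q_i`, `p_i u_i`, `p_{i+1} u_i`,
`q_i v_i`, `q_{i+1} v_i`. So the `i`-th hexagon (`1 ≤ i ≤ n`) is the cycle
`p_{i-1}, u_{i-1}, p_i, q_i, v_{i-1}, q_{i-1}`. -/
def edgeRel : HexVertex n → HexVertex n → Bool
  | p i, q j => i = j
  | p i, u j => i = j.castSucc ∨ i = j.succ
  | q i, v j => i = j.castSucc ∨ i = j.succ
  | _, _ => false

/-- The reflection exchanging the two sides: `p_i ↔ q_i`, `u_i ↔ v_i`. -/
def mirror : HexVertex n → HexVertex n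
  | p i => q i
  | q i => p i
  | u i => v i
  | v i => u i

/-- The reflection exchanging the two ends: `p_i ↦ p_{n-i}`, `q_i ↦ q_{n-i}`,
`u_i ↦ u_{n-1-i}`, `v_i ↦ v_{n-1-i}`. -/
def reverse : HexVertex n → HexVertex n
  | p i => p i.rev
  | q i => q i.rev
  | u i => u i.rev
  | v i => v i.rev

end HexVertex

/-- The linear hexagonal chain `L_n` with `n` hexagons. -/
def linearHexagonalChain (n : ℕ) : SimpleGraph (HexVertex n) :=
  SimpleGraph.fromRel fun x y => HexVertex.edgeRel x y = true

instance linearHexagonalChain.decidableRelAdj (n : ℕ) :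
    DecidableRel (linearHexagonalChain n).Adj := fun x y =>
  decidable_of_iff
    (x ≠ y ∧ (HexVertex.edgeRel x y = true ∨ HexVertex.edgeRel y x = true)) Iff.rfl

/-- The resistance distance in the linear hexagonal chain `L_n`. -/
noncomputable def hexResistance {n : ℕ} (x y : HexVertex n) : ℝ :=
  resistanceDistance (linearHexagonalChain n) x y

/-!
The chain consists of two copies of a path with `2 n + 1` vertices, joined by rungs at the even
positions, so a vertex is described by its `side` (`±1`) and its position `pos` along the path. The
Laplacian commutes with the exchange of the two sides and therefore acts separately on even and on
odd potentials. On even potentials the rungs carry no current and one is left with the Laplacian of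
a path, whose Green's function is `-|k - m| / 4` up to currents at the ends that do not depend on the
source. On odd potentials, eliminating the odd positions leaves the recurrence
`f (i - 1) + f (i + 1) = 6 * f i`, with the characteristic roots `α` and `α⁻¹`, where
`α = 3 - 2 * √2`. Its solution `oddMode` that satisfies the condition at the left end, and the
reflection of that solution, give Green's function `oddGreen` in the usual way, as a product
divided by the Wronskian.

The sum `hexGreen` of the two parts is Green's function of the chain (`hexGreen_lapMatrix`), and the
resistance between `x` and `y` is `K x x + K y y - K x y - K y x` with `K = hexGreen`
(`hexResistance_eq`). Since `K` is invariant under both reflections, so is the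
resistance. The closed formulas come from the explicit form `hexResistance_of_le` by algebra in
`α ^ n`, `α ^ i`, `α ^ j`, using `α ^ 2 = 6 * α - 1` and `α⁻¹ - α = 4 * √2`.
-/

/-! ### Coordinates on the chain -/

namespace HexVertex

variable {n : ℕ}

/-- The position of a vertex along its side of the chain: each of the two sides is the path
`p_0, u_0, p_1, u_1, …, p_n` (resp. `q_0, v_0, q_1, …, q_n`), numbered from `0` to `2 n`. -/
def pos : HexVertex n → ℤ
  | p i => 2 * i
  | q i => 2 * i
  | u i => 2 * i + 1
  | v i => 2 * i + 1

/-- The side of the chain a vertex lies on: `1` for `p_i`, `u_i` and `-1` for `q_i`, `v_i`. -/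
def side : HexVertex n → ℝ
  | p _ => 1
  | q _ => -1
  | u _ => 1
  | v _ => -1

theorem pos_nonneg (x : HexVertex n) : 0 ≤ x.pos := by
  cases x <;> simp only [pos] <;> omega

theorem pos_le (x : HexVertex n) : x.pos ≤ 2 * n := by
  cases x <;> simp only [pos] <;> omega

@[simp] theorem pos_mirror (x : HexVertex n) : x.mirror.pos = x.pos := by
  cases x <;> rfl

@[simp] theorem side_mirror (x : HexVertex n) : x.mirror.side = -x.side := by
  cases x <;> simp [side, mirror]

@[simp] theorem pos_reverse (x : HexVertex n) : x.reverse.pos = 2 * n - x.pos := by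
  cases x <;> simp only [pos, reverse, Fin.val_rev] <;> omega

@[simp] theorem side_reverse (x : HexVertex n) : x.reverse.side = x.side := by
  cases x <;> rfl

theorem side_mul_self (x : HexVertex n) : x.side * x.side = 1 := by
  cases x <;> simp [side]

/-- Position and side are coordinates on the chain; in terms of them the indicator function of a
vertex splits into a part that is even under the mirror reflection and a part that is odd. -/
theorem single_apply_eq (x y : HexVertex n) :
    (Pi.single y 1 : HexVertex n → ℝ) x =
      if x.pos = y.pos then (1 + x.side * y.side) / 2 else 0 := by
  rw [Pi.single_apply]
  cases x <;> cases y <;> simp [pos, side, Fin.ext_iff] <;> omega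

/-- The vertices of the chain as a disjoint union of the four families. -/
def equivSum (n : ℕ) :
    HexVertex n ≃ (Fin (n + 1) ⊕ Fin (n + 1)) ⊕ (Fin n ⊕ Fin n) where
  toFun
    | p i => .inl (.inl i)
    | q i => .inl (.inr i)
    | u i => .inr (.inl i)
    | v i => .inr (.inr i)
  invFun
    | .inl (.inl i) => p i
    | .inl (.inr i) => q i
    | .inr (.inl i) => u i
    | .inr (.inr i) => v i
  left_inv x := by cases x <;> rfl
  right_inv x := by rcases x with (x | x) | (x | x) <;> rfl

theorem sum_eq (f : HexVertex n → ℝ) :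
    ∑ x, f x = ((∑ i, f (p i)) + ∑ i, f (q i)) + ((∑ i, f (u i)) + ∑ i, f (v i)) := by
  rw [← (equivSum n).symm.sum_comp f]
  simp [Fintype.sum_sum_type, equivSum]

end HexVertex

/-! ### The Laplacian of the chain in coordinates -/

theorem SimpleGraph.lapMatrix_mulVec_eq_sum_sub {V : Type*} [Fintype V] [DecidableEq V]
    (G : SimpleGraph V) [DecidableRel G.Adj] (φ : V → ℝ) (x : V) :
    (G.lapMatrix ℝ).mulVec φ x = ∑ y, if G.Adj x y then φ x - φ y else 0 := by
  rw [SimpleGraph.lapMatrix_mulVec_apply, ← Finset.sum_filter,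
    ← SimpleGraph.neighborFinset_eq_filter, Finset.sum_sub_distrib]
  simp

/-- The vertices `u_j` adjacent to `p_i` are those at the positions `2 i ± 1`, of which one is missing
at an end of the chain. -/
theorem Fin.sum_ite_castSucc_or_succ {n : ℕ} (i : Fin (n + 1)) (H : ℤ → ℝ) :
    (∑ j : Fin n, if i = j.castSucc ∨ i = j.succ then H (2 * j + 1) else 0) =
      (if (2 * i : ℤ) = 2 * n then 0 else H (2 * i + 1)) +
        (if (2 * i : ℤ) = 0 then 0 else H (2 * i - 1)) := by
  have split : ∀ j : Fin n, (if i = j.castSucc ∨ i = j.succ then H (2 * j + 1) else 0) =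
      (if i = j.castSucc then H (2 * j + 1) else 0) +
        (if i = j.succ then H (2 * j + 1) else 0) := by
    intro j
    by_cases h1 : i = j.castSucc
    · have h2 : ¬ i = j.succ := by
        rw [h1, Fin.ext_iff]; simp
      rw [if_pos (Or.inl h1), if_pos h1, if_neg h2, add_zero]
    · simp [h1]
  rw [Finset.sum_congr rfl fun j _ => split j, Finset.sum_add_distrib]
  congr 1
  · refine Fin.lastCases ?_ (fun k => ?_) i
    · rw [Fin.val_last, if_pos rfl]
      exact Finset.sum_eq_zero fun j _ => if_neg j.castSucc_lt_last.ne'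
    · have hk : ¬ (2 * (k : ℕ) : ℤ) = 2 * n := by omega
      simp [hk]
  · refine Fin.cases ?_ (fun k => ?_) i
    · simp [Fin.ext_iff]
    · have hk : ¬ (2 * ((k : ℕ) + 1) : ℤ) = 0 := by omega
      simp [hk]
      ring_nf

/-- The vertices `p_i` adjacent to `u_j` are those at the positions `2 j` and `2 j + 2`. -/
theorem Fin.sum_ite_eq_castSucc_or_succ {n : ℕ} (j : Fin n) (H : ℤ → ℝ) :
    (∑ i : Fin (n + 1), if i = j.castSucc ∨ i = j.succ then H (2 * i) else 0) =
      H (2 * j) + H (2 * j + 2) := by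
  have split : ∀ i : Fin (n + 1), (if i = j.castSucc ∨ i = j.succ then H (2 * i) else 0) =
      (if i = j.castSucc then H (2 * i) else 0) + (if i = j.succ then H (2 * i) else 0) := by
    intro i
    by_cases h1 : i = j.castSucc
    · have h2 : ¬ i = j.succ := by
        rw [h1, Fin.ext_iff]; simp
      rw [if_pos (Or.inl h1), if_pos h1, if_neg h2, add_zero]
    · simp [h1]
  rw [Finset.sum_congr rfl fun j _ => split j, Finset.sum_add_distrib]
  simp
  ring_nf

open HexVertex in
/-- The Laplacian of the chain in the coordinates `side` and `pos`: a second difference along the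
side, the contribution of the rung `p_i q_i` at even positions, and corrections at the two ends,
which remove the currents to the positions `-1` and `2 n + 1` outside the chain. -/
theorem linearHexagonalChain_lapMatrix_mulVec {n : ℕ} (F : ℝ → ℤ → ℝ) (x : HexVertex n) :
    ((linearHexagonalChain n).lapMatrix ℝ).mulVec (fun z => F z.side z.pos) x =
      2 * F x.side x.pos - F x.side (x.pos - 1) - F x.side (x.pos + 1)
        + (if Even x.pos then F x.side x.pos - F (-x.side) x.pos else 0)
        - (if x.pos = 0 then F x.side 0 - F x.side (-1) else 0)
        - (if x.pos = 2 * n then F x.side (2 * n) - F x.side (2 * n + 1) else 0) := by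
  have hp : ∀ (i : Fin (n + 1)) (s : ℝ),
      (∑ j : Fin n, if i = j.castSucc ∨ i = j.succ then F s (2 * i) - F s (2 * j + 1) else 0) =
        2 * F s (2 * i) - F s (2 * i - 1) - F s (2 * i + 1)
          - (if (2 * i : ℤ) = 0 then F s 0 - F s (-1) else 0)
          - (if (2 * i : ℤ) = 2 * n then F s (2 * n) - F s (2 * n + 1) else 0) := by
    intro i s
    rw [Fin.sum_ite_castSucc_or_succ i fun k => F s (2 * i) - F s k]
    by_cases h0 : (2 * i : ℤ) = 0 <;> by_cases hn : (2 * i : ℤ) = 2 * n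
    · rw [if_pos hn, if_pos h0, if_pos h0, if_pos hn, ← hn, h0]; norm_num; ring
    · simp only [h0, if_neg (h0 ▸ hn)]; norm_num; ring
    · simp only [hn, if_neg (hn ▸ h0)]; norm_num; ring
    · simp only [h0, hn]; norm_num; ring
  have hu : ∀ (j : Fin n) (s : ℝ),
      (∑ i : Fin (n + 1), if i = j.castSucc ∨ i = j.succ then
        F s (2 * j + 1) - F s (2 * i) else 0) =
        2 * F s (2 * j + 1) - F s (2 * j) - F s (2 * j + 1 + 1) := by
    intro j s
    rw [Fin.sum_ite_eq_castSucc_or_succ j fun k => F s (2 * j + 1) - F s k]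
    ring_nf
  rw [SimpleGraph.lapMatrix_mulVec_eq_sum_sub, HexVertex.sum_eq]
  cases x with
  | p i =>
    have := hp i 1
    simp [linearHexagonalChain, edgeRel, pos, side] at this ⊢
    rw [this]; ring
  | q i =>
    have := hp i (-1)
    simp [linearHexagonalChain, edgeRel, pos, side] at this ⊢
    rw [this]; ring
  | u j =>
    have := hu j 1
    have h1 : ¬ (2 * (j : ℕ) + 1 : ℤ) = 0 := by omega
    have h2 : ¬ (2 * (j : ℕ) + 1 : ℤ) = 2 * n := by omega
    have h3 : ¬ Even (2 * (j : ℕ) + 1 : ℤ) := Int.not_even_two_mul_add_one _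
    simp [linearHexagonalChain, edgeRel, pos, side, h1, h2, h3,
      -Int.not_even_iff_odd] at this ⊢
    rw [this]
  | v j =>
    have := hu j (-1)
    have h1 : ¬ (2 * (j : ℕ) + 1 : ℤ) = 0 := by omega
    have h2 : ¬ (2 * (j : ℕ) + 1 : ℤ) = 2 * n := by omega
    have h3 : ¬ Even (2 * (j : ℕ) + 1 : ℤ) := Int.not_even_two_mul_add_one _
    simp [linearHexagonalChain, edgeRel, pos, side, h1, h2, h3,
      -Int.not_even_iff_odd] at this ⊢
    rw [this]

/-! ### Functions odd under the mirror reflection -/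

/-- The function on positions that solves `L φ = 0` for `φ = side * oddMode` away from the right end
of the chain, when `α ^ 2 = 6 * α - 1`. It is `α ^ (-i) + α ^ (i + 1)` at `2 i` and the mean of its
two neighbours at odd positions. It is defined on all of `ℤ`; the condition at the left end `0`
becomes `oddMode_neg_one`. -/
noncomputable def oddMode (α : ℝ) (k : ℤ) : ℝ :=
  if Even k then α ^ (-(k / 2)) + α ^ (k / 2 + 1)
  else (1 + α) / 2 * (α ^ (-(k / 2) - 1) + α ^ (k / 2 + 1))

section oddMode

variable {α : ℝ}

theorem oddMode_two_mul (i : ℤ) : oddMode α (2 * i) = α ^ (-i) + α ^ (i + 1) := by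
  simp [oddMode]

theorem oddMode_two_mul_add_one (i : ℤ) :
    oddMode α (2 * i + 1) = (1 + α) / 2 * (α ^ (-i - 1) + α ^ (i + 1)) := by
  rw [oddMode, if_neg (Int.not_even_two_mul_add_one i), show (2 * i + 1) / 2 = i by omega]

/-- No current flows between the positions `-1` and `0`. -/
theorem oddMode_neg_one : oddMode α (-1) = oddMode α 0 := by
  have h1 := oddMode_two_mul_add_one (α := α) (-1)
  have h0 := oddMode_two_mul (α := α) 0
  norm_num at h0 h1
  rw [h0, h1]

/-- The odd mode is harmonic: at `p_i` the rung to `q_i`, where the potential has the opposite sign,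
contributes the additional `2 * oddMode α k`. -/
theorem oddMode_add (h : α ^ 2 = 6 * α - 1) (hα : α ≠ 0) (k : ℤ) :
    oddMode α (k - 1) + oddMode α (k + 1) = (if Even k then 4 else 2) * oddMode α k := by
  obtain ⟨i, rfl | rfl⟩ := Int.even_or_odd' k
  · rw [if_pos (even_two_mul i), show 2 * i - 1 = 2 * (i - 1) + 1 by ring, oddMode_two_mul,
      oddMode_two_mul_add_one, oddMode_two_mul_add_one]
    simp only [neg_sub, zpow_add₀ hα, zpow_sub₀ hα, zpow_neg, zpow_one]
    field_simp
    linear_combination (1 + α * (α ^ i) ^ 2) * h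
  · rw [if_neg (Int.not_even_two_mul_add_one i), show 2 * i + 1 - 1 = 2 * i by ring,
      show 2 * i + 1 + 1 = 2 * (i + 1) by ring, oddMode_two_mul, oddMode_two_mul_add_one,
      oddMode_two_mul]
    simp only [neg_add, zpow_add₀ hα, zpow_sub₀ hα, zpow_neg, zpow_one]
    field_simp
    ring

/-- The Wronskian of the odd mode and its reflection `k ↦ oddMode α (2 * n - k)`, in closed form. -/
noncomputable def oddWronskian (α : ℝ) (n : ℕ) : ℝ :=
  (α⁻¹ - α) / 2 * α ^ (-n : ℤ) * (1 - α ^ (2 * n + 2 : ℤ))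

theorem oddWronskian_eq (hα : α ≠ 0) (n : ℕ) (k : ℤ) :
    oddMode α (k + 1) * oddMode α (2 * n - k) - oddMode α k * oddMode α (2 * n - k - 1) =
      oddWronskian α n := by
  obtain ⟨i, rfl | rfl⟩ := Int.even_or_odd' k
  · rw [show 2 * (n : ℤ) - 2 * i - 1 = 2 * (n - i - 1) + 1 by ring,
      show 2 * (n : ℤ) - 2 * i = 2 * (n - i) by ring]
    simp only [oddWronskian, oddMode_two_mul, oddMode_two_mul_add_one, neg_sub,
      zpow_add₀ hα, zpow_sub₀ hα, zpow_neg, zpow_mul', zpow_ofNat]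
    field_simp
    ring
  · rw [show 2 * (n : ℤ) - (2 * i + 1) - 1 = 2 * (n - i - 1) by ring,
      show 2 * (n : ℤ) - (2 * i + 1) = 2 * (n - i - 1) + 1 by ring,
      show 2 * i + 1 + 1 = 2 * (i + 1) by ring]
    simp only [oddWronskian, oddMode_two_mul, oddMode_two_mul_add_one, neg_add, neg_sub,
      zpow_add₀ hα, zpow_sub₀ hα, zpow_neg, zpow_mul', zpow_ofNat]
    field_simp
    ring

/-- The kernel which, divided by the Wronskian, is Green's function for odd potentials: it is built
from the solution `oddMode` satisfying the condition at the left end and from its reflection, which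
satisfies the condition at the right end. The source is at `m`. -/
noncomputable def oddGreen (α : ℝ) (n : ℕ) (m k : ℤ) : ℝ :=
  oddMode α (min k m) * oddMode α (2 * n - max k m)

theorem oddGreen_comm (n : ℕ) (m k : ℤ) : oddGreen α n m k = oddGreen α n k m := by
  rw [oddGreen, oddGreen, min_comm, max_comm]

theorem oddGreen_reverse (n : ℕ) (m k : ℤ) :
    oddGreen α n (2 * n - m) (2 * n - k) = oddGreen α n m k := by
  rw [oddGreen, oddGreen, min_sub_sub_left, max_sub_sub_left, mul_comm]
  congr 2
  ring

theorem oddGreen_of_le {n : ℕ} {m k : ℤ} (h : k ≤ m) :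
    oddGreen α n m k = oddMode α k * oddMode α (2 * n - m) := by
  rw [oddGreen, min_eq_left h, max_eq_right h]

theorem oddGreen_of_ge {n : ℕ} {m k : ℤ} (h : m ≤ k) :
    oddGreen α n m k = oddMode α m * oddMode α (2 * n - k) := by
  rw [oddGreen_comm, oddGreen_of_le h]

theorem oddGreen_neg_one {n : ℕ} {m : ℤ} (h : 0 ≤ m) :
    oddGreen α n m (-1) = oddGreen α n m 0 := by
  rw [oddGreen_of_le h, oddGreen_of_le (by omega), oddMode_neg_one]

theorem oddGreen_two_mul_add_one {n : ℕ} {m : ℤ} (h : m ≤ 2 * n) :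
    oddGreen α n m (2 * n + 1) = oddGreen α n m (2 * n) := by
  rw [oddGreen_of_ge h, oddGreen_of_ge (by omega), sub_self,
    show 2 * (n : ℤ) - (2 * n + 1) = -1 by ring, oddMode_neg_one]

/-- The equation of Green's function: by `oddMode_add` there is no current into a position other than
the source, and at the source it is the Wronskian. -/
theorem oddGreen_add (h : α ^ 2 = 6 * α - 1) (hα : α ≠ 0) (n : ℕ) (m k : ℤ) :
    (if Even k then 4 else 2) * oddGreen α n m k - oddGreen α n m (k - 1)
      - oddGreen α n m (k + 1) = if k = m then oddWronskian α n else 0 := by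
  rcases lt_trichotomy k m with hk | rfl | hk
  · rw [if_neg hk.ne, oddGreen_of_le hk.le, oddGreen_of_le (by omega), oddGreen_of_le (by omega)]
    linear_combination -oddMode α (2 * n - m) * oddMode_add h hα k
  · rw [if_pos rfl, oddGreen_of_le le_rfl, oddGreen_of_le (by omega), oddGreen_of_ge (by omega),
      ← oddWronskian_eq hα n k, ← sub_sub]
    linear_combination -oddMode α (2 * n - k) * oddMode_add h hα k
  · have key := oddMode_add h hα (2 * n - k)
    have : Even (2 * (n : ℤ) - k) ↔ Even k := by simp [Int.even_sub]
    simp only [this, show 2 * (n : ℤ) - k - 1 = 2 * n - (k + 1) by ring,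
      show 2 * (n : ℤ) - k + 1 = 2 * n - (k - 1) by ring] at key
    rw [if_neg hk.ne', oddGreen_of_ge hk.le, oddGreen_of_ge (by omega), oddGreen_of_ge (by omega)]
    linear_combination -oddMode α m * key

end oddMode

/-! ### Green's function of the chain and the resistance -/

/-- Green's function of the chain with source at `y`, the sum of its even and odd part under the
mirror reflection. The even part, `-|k - m| / 4` in terms of positions, lets the unit current leave
through the four corners. -/
noncomputable def hexGreen {n : ℕ} (α : ℝ) (y x : HexVertex n) : ℝ :=
  -|(x.pos - y.pos : ℝ)| / 4
    + x.side * y.side * oddGreen α n y.pos x.pos / (2 * oddWronskian α n)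

theorem abs_sub_second_difference (m k : ℤ) :
    |((k - 1 : ℤ) - m : ℝ)| + |((k + 1 : ℤ) - m : ℝ)| - 2 * |(k - m : ℝ)| =
      if k = m then 2 else 0 := by
  rcases lt_trichotomy k m with hk | rfl | hk
  · have h : (k : ℝ) + 1 ≤ m := by exact_mod_cast hk
    rw [if_neg hk.ne, abs_of_nonpos, abs_of_nonpos, abs_of_nonpos] <;> push_cast <;> linarith
  · simp; norm_num
  · have h : (m : ℝ) + 1 ≤ k := by exact_mod_cast hk
    rw [if_neg hk.ne', abs_of_nonneg, abs_of_nonneg, abs_of_nonneg] <;> push_cast <;> linarith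

/-- A unit current enters at `y` and a quarter of it leaves at each corner of the chain (for `n = 0`,
where the corners coincide in pairs, a half at each vertex). -/
theorem hexGreen_lapMatrix {n : ℕ} {α : ℝ} (h : α ^ 2 = 6 * α - 1) (hα : α ≠ 0)
    (hW : oddWronskian α n ≠ 0) (x y : HexVertex n) :
    ((linearHexagonalChain n).lapMatrix ℝ).mulVec (hexGreen α y) x =
      (Pi.single y 1 : HexVertex n → ℝ) x
        - ((if x.pos = 0 then 1 / 4 else 0) + (if x.pos = 2 * n then 1 / 4 else 0)) := by
  have key := linearHexagonalChain_lapMatrix_mulVec (n := n)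
    (fun s k => -|(k - y.pos : ℝ)| / 4
      + s * y.side * oddGreen α n y.pos k / (2 * oddWronskian α n)) x
  have hy0 := y.pos_nonneg
  have hyn := y.pos_le
  have hy0' : (0 : ℝ) ≤ y.pos := by exact_mod_cast hy0
  have hyn' : (y.pos : ℝ) ≤ 2 * n := by exact_mod_cast hyn
  have e0 : |((0 : ℤ) - y.pos : ℝ)| = y.pos := by
    rw [abs_of_nonpos] <;> push_cast <;> linarith
  have e1 : |((-1 : ℤ) - y.pos : ℝ)| = y.pos + 1 := by
    rw [abs_of_nonpos] <;> push_cast <;> linarith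
  have e2 : |((2 * n : ℤ) - y.pos : ℝ)| = 2 * n - y.pos := by
    rw [abs_of_nonneg] <;> push_cast <;> linarith
  have e3 : |((2 * n + 1 : ℤ) - y.pos : ℝ)| = 2 * n + 1 - y.pos := by
    rw [abs_of_nonneg] <;> push_cast <;> linarith
  simp only [e0, e1, e2, e3, oddGreen_neg_one hy0, oddGreen_two_mul_add_one hyn] at key
  refine key.trans ?_
  rw [HexVertex.single_apply_eq]
  have d1 := abs_sub_second_difference y.pos x.pos
  have d2 := oddGreen_add h hα n y.pos x.pos
  have d2' : x.side * y.side *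
      ((if Even x.pos then 4 else 2) * oddGreen α n y.pos x.pos
        - oddGreen α n y.pos (x.pos - 1) - oddGreen α n y.pos (x.pos + 1)) /
        (2 * oddWronskian α n) = if x.pos = y.pos then x.side * y.side / 2 else 0 := by
    rw [d2]
    split_ifs
    · field_simp
    · simp
  have d3 : (if x.pos = y.pos then (1 + x.side * y.side) / 2 else 0) =
      (if x.pos = y.pos then (2 : ℝ) else 0) / 4
        + if x.pos = y.pos then x.side * y.side / 2 else 0 := by
    split_ifs <;> ring
  rw [d3, ← d1, ← d2']
  split_ifs <;> ring

/-- In the difference of two Green's functions the currents through the corners cancel. -/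
theorem hexResistance_eq {n : ℕ} {α : ℝ} (h : α ^ 2 = 6 * α - 1) (hα : α ≠ 0)
    (hW : oddWronskian α n ≠ 0) (x y : HexVertex n) :
    hexResistance x y =
      hexGreen α x x + hexGreen α y y - hexGreen α x y - hexGreen α y x := by
  have hφ : IsUnitCurrentPotential (linearHexagonalChain n) x y
      (hexGreen α x - hexGreen α y) := by
    ext z
    rw [Matrix.mulVec_sub, Pi.sub_apply, Pi.sub_apply, hexGreen_lapMatrix h hα hW,
      hexGreen_lapMatrix h hα hW]
    ring
  rw [hexResistance, resistanceDistance_eq _ hφ, Pi.sub_apply, Pi.sub_apply]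
  ring

theorem hexGreen_comm {n : ℕ} (α : ℝ) (x y : HexVertex n) : hexGreen α x y = hexGreen α y x := by
  rw [hexGreen, hexGreen, abs_sub_comm, oddGreen_comm, mul_comm y.side]

theorem hexGreen_mirror {n : ℕ} (α : ℝ) (x y : HexVertex n) :
    hexGreen α x.mirror y.mirror = hexGreen α x y := by
  simp [hexGreen]

theorem hexGreen_reverse {n : ℕ} (α : ℝ) (x y : HexVertex n) :
    hexGreen α x.reverse y.reverse = hexGreen α x y := by
  simp [hexGreen, oddGreen_reverse]
  rw [abs_sub_comm]

/-- The resistance between any two vertices, in terms of their coordinates. -/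
theorem hexResistance_of_le {n : ℕ} {α : ℝ} (h : α ^ 2 = 6 * α - 1) (hα : α ≠ 0)
    (hW : oddWronskian α n ≠ 0) {x y : HexVertex n} (hxy : y.pos ≤ x.pos) :
    hexResistance x y = (x.pos - y.pos : ℝ) / 2
      + (oddMode α x.pos * oddMode α (2 * n - x.pos) + oddMode α y.pos * oddMode α (2 * n - y.pos)
          - 2 * (x.side * y.side) * (oddMode α y.pos * oddMode α (2 * n - x.pos))) /
        (2 * oddWronskian α n) := by
  have hxy' : (0 : ℝ) ≤ x.pos - y.pos := sub_nonneg.mpr (by exact_mod_cast hxy)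
  rw [hexResistance_eq h hα hW, hexGreen_comm α x y]
  simp only [hexGreen, oddGreen_of_ge hxy, oddGreen_of_le le_rfl, HexVertex.side_mul_self,
    sub_self, abs_zero, abs_of_nonneg hxy']
  ring

/-! ### The closed formulas -/

theorem oddMode_two_mul_sub_two_mul {α : ℝ} (a i : ℤ) :
    oddMode α (2 * a - 2 * i) = α ^ (i - a) + α ^ (a - i + 1) := by
  rw [← mul_sub, oddMode_two_mul, neg_sub]

theorem oddMode_two_mul_sub_two_mul_add_one {α : ℝ} (a i : ℤ) :
    oddMode α (2 * a - (2 * i + 1)) = (1 + α) / 2 * (α ^ (i - a) + α ^ (a - i)) := by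
  rw [show 2 * a - (2 * i + 1) = 2 * (a - i - 1) + 1 by ring, oddMode_two_mul_add_one]
  ring_nf

theorem two_mul_oddWronskian {α : ℝ} (hα : α = 3 - 2 * √2) (n : ℕ) :
    2 * oddWronskian α n = 4 * √2 * (1 - α ^ (2 * n + 2 : ℤ)) / α ^ (n : ℤ) := by
  have h2 : √2 ^ 2 = 2 := Real.sq_sqrt (by norm_num)
  have hinv : α⁻¹ = 3 + 2 * √2 := by
    refine inv_eq_of_mul_eq_one_right ?_
    rw [hα]
    linear_combination -4 * h2
  rw [oddWronskian, hinv, zpow_neg, hα]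
  ring

open HexVertex in
theorem mainTheorem1 (n : ℕ) (α : ℝ) (hα : α = 3 - 2 * √2) :
    -- `r(p_n, p_i)`
    (∀ i : Fin (n + 1), hexResistance (p (Fin.last n)) (p i) =
      (n - i : ℝ) + (1 - α ^ (n - i : ℤ)) *
        (2 - 2 * α ^ (n + i + 2 : ℤ) - α ^ (n + i + 1 : ℤ) - α ^ (n - i + 1 : ℤ)
          + α ^ (2 * i + 1 : ℤ) + α) / (4 * √2 * (1 - α ^ (2 * n + 2 : ℤ)))) ∧
    -- `r(p_n, q_i)`
    (∀ i : Fin (n + 1), hexResistance (p (Fin.last n)) (q i) =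
      (n - i : ℝ) + (1 + α ^ (n - i : ℤ)) *
        (2 + 2 * α ^ (n + i + 2 : ℤ) + α ^ (n + i + 1 : ℤ) + α ^ (n - i + 1 : ℤ)
          + α ^ (2 * i + 1 : ℤ) + α) / (4 * √2 * (1 - α ^ (2 * n + 2 : ℤ)))) ∧
    -- `r(p_i, q_i)`
    (∀ i : Fin (n + 1), hexResistance (p i) (q i) =
      (1 + α ^ (2 * n - 2 * i + 1 : ℤ)) * (1 + α ^ (2 * i + 1 : ℤ)) /
        (√2 * (1 - α ^ (2 * n + 2 : ℤ)))) ∧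
    -- `r(p_i, p_j)`
    (∀ i j : Fin (n + 1), (j : ℕ) ≤ i → hexResistance (p i) (p j) =
      (i - j : ℝ) + (1 - α ^ (i - j : ℤ)) / (4 * √2 * (1 - α ^ (2 * n + 2 : ℤ))) *
        (2 - α ^ (i + j + 1 : ℤ) + α ^ (2 * j + 1 : ℤ)
          + α ^ (2 * n - 2 * i + 1 : ℤ) * (1 - α ^ (i - j : ℤ) - 2 * α ^ (i + j + 1 : ℤ)))) ∧
    -- `r(q_i, p_j)`
    (∀ i j : Fin (n + 1), (j : ℕ) ≤ i → hexResistance (q i) (p j) =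
      (i - j : ℝ) + (1 + α ^ (i - j : ℤ)) / (4 * √2 * (1 - α ^ (2 * n + 2 : ℤ))) *
        (2 + α ^ (i + j + 1 : ℤ) + α ^ (2 * j + 1 : ℤ)
          + α ^ (2 * n - 2 * i + 1 : ℤ) * (1 + α ^ (i - j : ℤ) + 2 * α ^ (i + j + 1 : ℤ)))) ∧
    -- `r(u_i, v_i)`
    (∀ i : Fin n, hexResistance (u i) (v i) =
      √2 * (1 + α ^ (2 * i + 2 : ℤ)) * (1 + α ^ (2 * n - 2 * i : ℤ)) /
        (1 - α ^ (2 * n + 2 : ℤ))) ∧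
    -- `r(p_n, u_i)`
    (∀ i : Fin n, hexResistance (p (Fin.last n)) (u i) =
      √2 * (1 - α ^ (n - i : ℤ)) *
        (3 + α ^ (2 * i + 2 : ℤ) - α ^ (n - i : ℤ) - 3 * α ^ (n + i + 2 : ℤ)) /
        (4 * (1 - α ^ (2 * n + 2 : ℤ))) + (n - i - 1 : ℝ)) ∧
    -- `r(p_n, v_i)`
    (∀ i : Fin n, hexResistance (p (Fin.last n)) (v i) =
      √2 * (1 + α ^ (n - i : ℤ)) *
        (3 + α ^ (2 * i + 2 : ℤ) + α ^ (n - i : ℤ) + 3 * α ^ (n + i + 2 : ℤ)) /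
        (4 * (1 - α ^ (2 * n + 2 : ℤ))) + (n - i - 1 : ℝ)) ∧
    -- `r(u_i, p_j)`
    (∀ (i : Fin n) (j : Fin (n + 1)), (j : ℕ) ≤ i → hexResistance (u i) (p j) =
      (i - j : ℝ) +
        (2 * α ^ (2 * i + 2 : ℤ) + α ^ (2 * n - 2 * j + 1 : ℤ) + 2 * α ^ (2 * n - 2 * i : ℤ)
          + α ^ (2 * n + 3 : ℤ)
          - α ^ (-i - j : ℤ) * (α + 1) * (1 + α ^ (2 * j + 1 : ℤ)) *
              (α ^ (2 * i : ℤ) + α ^ (2 * n : ℤ))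
          + α ^ (-1 : ℤ) + α ^ (2 * j + 1 : ℤ)) / (4 * √2 * (1 - α ^ (2 * n + 2 : ℤ)))) ∧
    -- `r(v_i, p_j)`
    (∀ (i : Fin n) (j : Fin (n + 1)), (j : ℕ) ≤ i → hexResistance (v i) (p j) =
      (i - j : ℝ) +
        (2 * α ^ (2 * i + 2 : ℤ) + α ^ (2 * n - 2 * j + 1 : ℤ) + 2 * α ^ (2 * n - 2 * i : ℤ)
          + α ^ (2 * n + 3 : ℤ)
          + α ^ (-i - j : ℤ) * (α + 1) * (1 + α ^ (2 * j + 1 : ℤ)) *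
              (α ^ (2 * i : ℤ) + α ^ (2 * n : ℤ))
          + α ^ (-1 : ℤ) + α ^ (2 * j + 1 : ℤ)) / (4 * √2 * (1 - α ^ (2 * n + 2 : ℤ)))) ∧
    -- `r(u_i, u_j)`
    (∀ i j : Fin n, (j : ℕ) ≤ i → hexResistance (u i) (u j) =
      (i - j : ℝ) +
        (α ^ (i + 1 : ℤ) - α ^ (j + 1 : ℤ)) *
          (α ^ (i + 1 : ℤ) - α ^ (j + 1 : ℤ) - 2 * α ^ (-j - 1 : ℤ)
            + α ^ (2 * n - i - 2 * j - 1 : ℤ) - α ^ (2 * n - j - 2 * i - 1 : ℤ)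
            + 2 * α ^ (2 * n - i + 1 : ℤ)) / (2 * √2 * (1 - α ^ (2 * n + 2 : ℤ)))) ∧
    -- `r(v_i, u_j)`
    (∀ i j : Fin n, (j : ℕ) ≤ i → hexResistance (v i) (u j) =
      (i - j : ℝ) +
        (α ^ (i + 1 : ℤ) + α ^ (j + 1 : ℤ)) *
          (α ^ (i + 1 : ℤ) + α ^ (j + 1 : ℤ) + 2 * α ^ (-j - 1 : ℤ)
            + α ^ (2 * n - i - 2 * j - 1 : ℤ) + α ^ (2 * n - j - 2 * i - 1 : ℤ)
            + 2 * α ^ (2 * n - i + 1 : ℤ)) / (2 * √2 * (1 - α ^ (2 * n + 2 : ℤ)))) ∧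
    -- all remaining pairs reduce to the ones above by symmetry
    (∀ x y : HexVertex n, hexResistance x x = 0 ∧ hexResistance x y = hexResistance y x ∧
      hexResistance x.mirror y.mirror = hexResistance x y ∧
      hexResistance x.reverse y.reverse = hexResistance x y) := by
  have h2 : √2 ^ 2 = 2 := Real.sq_sqrt (by norm_num)
  have h2' : √2 ≠ 0 := by positivity
  have h : α ^ 2 = 6 * α - 1 := by
    rw [hα]
    linear_combination 4 * h2
  have hα0 : 0 < α := by
    rw [hα]
    nlinarith [Real.sqrt_nonneg 2]
  have hα1 : α < 1 := by
    rw [hα]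
    nlinarith [Real.sqrt_nonneg 2]
  have hne : α ≠ 0 := hα0.ne'
  have hc : α ^ (n : ℤ) ≠ 0 := zpow_ne_zero _ hne
  have hD : 1 - α ^ (2 * n + 2 : ℤ) ≠ 0 :=
    (sub_pos.mpr (zpow_lt_one₀ hα0 hα1 (by omega))).ne'
  have hW : oddWronskian α n ≠ 0 := by
    have : 2 * oddWronskian α n ≠ 0 := by
      rw [two_mul_oddWronskian hα]
      positivity
    exact right_ne_zero_of_mul this
  have key {x y : HexVertex n} (hxy : y.pos ≤ x.pos) :=
    two_mul_oddWronskian hα n ▸ hexResistance_of_le h hne hW hxy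
  have odd_mul_odd (a b : ℝ) : (1 + α) / 2 * a * ((1 + α) / 2 * b) = 2 * α * (a * b) := by
    linear_combination a * b / 4 * h
  -- Shifting the position by one changes the linear term by `1 / 2`, which the formulas with
  -- one of the `u_i`, `v_i` absorb into the fraction by means of the value of its denominator.
  have hD' : 1 - α ^ (2 * n + 2 : ℤ) = 1 - α ^ 2 * (α ^ (n : ℤ)) ^ 2 := by
    simp only [zpow_add₀ hne, zpow_mul', zpow_ofNat]
    ring
  have h8 : 4 * √2 * α = 1 - α ^ 2 := by
    rw [hα]
    linear_combination -4 * h2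
  generalize 1 - α ^ (2 * n + 2 : ℤ) = D at hD hD' key ⊢
  refine ⟨fun i => ?_, fun i => ?_, fun i => ?_, fun i j hij => ?_, fun i j hij => ?_,
    fun i => ?_, fun i => ?_, fun i => ?_, fun i j hij => ?_, fun i j hij => ?_,
    fun i j hij => ?_, fun i j hij => ?_, ?symmetry⟩
  case symmetry =>
    intro x y
    simp only [hexResistance_eq h hne hW, hexGreen_mirror, hexGreen_reverse, and_true]
    exact ⟨by ring, by ring⟩
  all_goals
    rw [key (by simp only [pos, Fin.val_last]; omega)]
    simp only [pos, side, Fin.val_last, oddMode_two_mul_sub_two_mul,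
      oddMode_two_mul_sub_two_mul_add_one, oddMode_two_mul, oddMode_two_mul_add_one, odd_mul_odd,
      zpow_add₀ hne, zpow_sub₀ hne, zpow_neg, zpow_mul', zpow_ofNat]
    push_cast
    field_simp
  · ring
  · ring
  · ring
  · ring
  · ring
  · rw [h2]
    ring
  · generalize α ^ (n : ℤ) = c at hD' ⊢
    generalize α ^ (i : ℤ) = a
    linear_combination a ^ 2 * D * h8 + a ^ 2 * (1 - α ^ 2) * hD'
      + (a ^ 2 + a ^ 2 * c ^ 2 * α ^ 2 - 2 * c * a * (1 + α ^ 2 * a ^ 2)) * h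
      - 2 * α * (a - c) * (a * (3 + α ^ 2 * a ^ 2) - c - c * α ^ 2 * a ^ 2 * 3) * h2
  · generalize α ^ (n : ℤ) = c at hD' ⊢
    generalize α ^ (i : ℤ) = a
    linear_combination a ^ 2 * D * h8 + a ^ 2 * (1 - α ^ 2) * hD'
      + (a ^ 2 + a ^ 2 * c ^ 2 * α ^ 2 + 2 * c * a * (1 + α ^ 2 * a ^ 2)) * h
      - 2 * α * (a + c) * (a * (3 + α ^ 2 * a ^ 2) + c + c * α ^ 2 * a ^ 2 * 3) * h2
  · generalize α ^ (n : ℤ) = c at hD' ⊢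
    generalize α ^ (i : ℤ) = a
    generalize α ^ (j : ℤ) = b
    linear_combination a ^ 2 * b ^ 2 * D * h8 + a ^ 2 * b ^ 2 * (1 - α ^ 2) * hD'
      - a ^ 2 * b ^ 2 * (1 + c ^ 2 * α ^ 2) * h
  · generalize α ^ (n : ℤ) = c at hD' ⊢
    generalize α ^ (i : ℤ) = a
    generalize α ^ (j : ℤ) = b
    linear_combination a ^ 2 * b ^ 2 * D * h8 + a ^ 2 * b ^ 2 * (1 - α ^ 2) * hD'
      - a ^ 2 * b ^ 2 * (1 + c ^ 2 * α ^ 2) * h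
  · ring
  · ring
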